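/- Let $\mathfrak g=\mathfrak g_{6,15}$ be the 2-step nilpotent real Lie algebra with basis $X_1,\dots,X_6$ whose only non-zero brackets of basis vectors (up to skew-symmetry) are $$[X_6,X_5]=X_3,\qquad [X_6,X_4]=X_1,\qquad [X_5,X_4]=X_2 .$$ Let $\mathfrak z$ be its center, let $G$ be the connected and simply connected Lie group with Lie algebra $\mathfrak g$, acting on the linear dual $\mathfrak g^*$ by the coadjoint action, and let $\mathfrak z^\perp=\{\xi\in\mathfrak g^*\mid \xi|_{\mathfrak z}=0\}$. For $\xi\in\mathfrak g^*$ write $\xi_j=\langle\xi,X_j\rangle$, $j=1,\dots,6$, and let $G\xi$ be the coadjoint orbit of $\xi$. Then: (i) The polynomial function $C\colon\mathfrak g^*\to\mathbb R$, $C(\xi)=\xi_2\xi_6+\xi_3\xi_4-\xi_1\xi_5$, is constant on every coadjoint orbit in $\mathfrak g^*$. (ii) The 2-dimensional coadjoint orbits are exactly the orbits contained in $\mathfrak g^*\setminus\mathfrak z^\perp$, and the mapping $$\Psi\colon(\mathfrak g^*\setminus\mathfrak z^\perp)/G\to(\mathfrak z^*\setminus\{0\})\times\mathbb R,\qquad \Psi(G\xi)=(\xi|_{\mathfrak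 z},C(\xi)),$$ is well defined and is a homeomorphism, where the orbit space carries the quotient topology. -/

import Mathlib

open scoped Manifold ContDiff

noncomputable section

namespace G615

/-! ### The Lie algebra

A vector `x : Alg` is written in coordinates with respect to the basis `X₁, …, X₆`; the
coordinate `x j`, `j : Fin 6`, is the coefficient of `X_{j+1}`. -/

/-- The underlying real vector space of the Lie algebra, with its standard topology. -/
def Alg : Type := Fin 6 → ℝ

instance : NormedAddCommGroup Alg := inferInstanceAs (NormedAddCommGroup (Fin 6 → ℝ))
instance : NormedSpace ℝ Alg := inferInstanceAs (NormedSpace ℝ (Fin 6 → ℝ))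
instance : FiniteDimensional ℝ Alg := inferInstanceAs (FiniteDimensional ℝ (Fin 6 → ℝ))

/-- The standard basis of the Lie algebra; `X j` is `X_{j+1}`. -/
def X : Module.Basis (Fin 6) ℝ Alg := Pi.basisFun ℝ (Fin 6)

/-- The Lie bracket, determined by
`[X₆, X₅] = X₃`, `[X₆, X₄] = X₁`, `[X₅, X₄] = X₂` (the other brackets of basis vectors with
decreasing indices being zero). -/
def bracket (x y : Alg) : Alg :=
  ![x 5 * y 3 - x 3 * y 5, x 4 * y 3 - x 3 * y 4, x 5 * y 4 - x 4 * y 5, 0, 0, 0]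

@[ext] theorem Alg.ext {x y : Alg} (h : ∀ j, x j = y j) : x = y := funext h

@[simp] theorem add_coord (x y : Alg) (j : Fin 6) : (x + y) j = x j + y j := rfl
@[simp] theorem sub_coord (x y : Alg) (j : Fin 6) : (x - y) j = x j - y j := rfl
@[simp] theorem neg_coord (x : Alg) (j : Fin 6) : (-x) j = -x j := rfl
@[simp] theorem zero_coord (j : Fin 6) : (0 : Alg) j = 0 := rfl
@[simp] theorem smul_coord (c : ℝ) (x : Alg) (j : Fin 6) : (c • x) j = c * x j := rfl

instance : Bracket Alg Alg := ⟨bracket⟩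

@[simp] theorem lie_coord_0 (x y : Alg) : ⁅x, y⁆ 0 = x 5 * y 3 - x 3 * y 5 := rfl
@[simp] theorem lie_coord_1 (x y : Alg) : ⁅x, y⁆ 1 = x 4 * y 3 - x 3 * y 4 := rfl
@[simp] theorem lie_coord_2 (x y : Alg) : ⁅x, y⁆ 2 = x 5 * y 4 - x 4 * y 5 := rfl
@[simp] theorem lie_coord_3 (x y : Alg) : ⁅x, y⁆ 3 = 0 := rfl
@[simp] theorem lie_coord_4 (x y : Alg) : ⁅x, y⁆ 4 = 0 := rfl
@[simp] theorem lie_coord_5 (x y : Alg) : ⁅x, y⁆ 5 = 0 := rfl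

theorem X_coord (i j : Fin 6) : X i j = if j = i then 1 else 0 :=
  (congrFun (Pi.basisFun_apply ℝ (Fin 6) i) j).trans (Pi.single_apply i 1 j)

instance : LieRing Alg where
  add_lie x y z := by
    ext j; fin_cases j <;> simp <;> ring
  lie_add x y z := by
    ext j; fin_cases j <;> simp <;> ring
  lie_self x := by
    ext j; fin_cases j <;> simp <;> ring
  leibniz_lie x y z := by
    ext j; fin_cases j <;> simp

instance : LieAlgebra ℝ Alg where
  lie_smul c x y := by
    ext j; fin_cases j <;> simp <;> ring

/-- The commutation relations that define the Lie algebra. -/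
theorem commutation_relations :
    ⁅X 5, X 4⁆ = X 2 ∧ ⁅X 5, X 3⁆ = X 0 ∧ ⁅X 4, X 3⁆ = X 1 ∧
    ∀ i j : Fin 6, i < 3 → ⁅X i, X j⁆ = 0 := by
  refine ⟨?_, ?_, ?_, fun i j hi => ?_⟩
  · ext j; fin_cases j <;> simp [X_coord]
  · ext j; fin_cases j <;> simp [X_coord]
  · ext j; fin_cases j <;> simp [X_coord]
  · have h3 : ¬ (3 = i) := by omega
    have h4 : ¬ (4 = i) := by omega
    have h5 : ¬ (5 = i) := by omega
    ext k
    fin_cases k <;> simp [X_coord, h3, h4, h5]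

/-- The Lie algebra is 2-step nilpotent. -/
@[simp] theorem lie_lie_eq_zero (x y z : Alg) : ⁅x, ⁅y, z⁆⁆ = 0 := by
  ext j; fin_cases j <;> simp

@[simp] theorem lie_lie_eq_zero' (x y z : Alg) : ⁅⁅x, y⁆, z⁆ = 0 := by
  rw [← lie_skew, lie_lie_eq_zero, neg_zero]

/-! ### The simply connected Lie group -/

/-- The connected and simply connected Lie group of the Lie algebra: the manifold `Alg` with the
Baker–Campbell–Hausdorff product `x y = x + y + [x, y] / 2` (the further terms of the series
vanish). In this realization the exponential map is the identity map of `Alg`. -/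
def Grp : Type := Alg

instance : TopologicalSpace Grp := inferInstanceAs (TopologicalSpace Alg)
instance : ChartedSpace Alg Grp := inferInstanceAs (ChartedSpace Alg Alg)

/-- The exponential map. -/
def exp (x : Alg) : Grp := x

/-- The inverse of the exponential map. -/
def log (a : Grp) : Alg := a

@[simp] theorem exp_log (a : Grp) : exp (log a) = a := rfl
@[simp] theorem log_exp (x : Alg) : log (exp x) = x := rfl

instance : Mul Grp := ⟨fun a b => exp (log a + log b + (1 / 2 : ℝ) • ⁅log a, log b⁆)⟩
instance : One Grp := ⟨exp 0⟩
instance : Inv Grp := ⟨fun a => exp (-log a)⟩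

@[simp] theorem log_mul (a b : Grp) :
    log (a * b) = log a + log b + (1 / 2 : ℝ) • ⁅log a, log b⁆ := rfl
@[simp] theorem log_one : log 1 = 0 := rfl
@[simp] theorem log_inv (a : Grp) : log a⁻¹ = -log a := rfl

theorem log_injective : Function.Injective log := fun _ _ h => h

instance : Group Grp where
  mul_assoc a b c := by
    apply log_injective
    simp
    abel
  one_mul a := by
    apply log_injective
    simp
  mul_one a := by
    apply log_injective
    simp
  inv_mul_cancel a := by
    apply log_injective
    simp

theorem contDiff_bracket : ContDiff ℝ ∞ (fun p : Alg × Alg => ⁅p.1, p.2⁆) := by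
  have h1 : ∀ j : Fin 6, ContDiff ℝ ∞ (fun p : Alg × Alg => p.1 j) := fun j =>
    (contDiff_apply ℝ ℝ j).comp (contDiff_fst (E := Alg) (F := Alg))
  have h2 : ∀ j : Fin 6, ContDiff ℝ ∞ (fun p : Alg × Alg => p.2 j) := fun j =>
    (contDiff_apply ℝ ℝ j).comp (contDiff_snd (E := Alg) (F := Alg))
  refine contDiff_pi' (F' := fun _ => ℝ) fun j => ?_
  fin_cases j
  · exact ((h1 5).mul (h2 3)).sub ((h1 3).mul (h2 5))
  · exact ((h1 4).mul (h2 3)).sub ((h1 3).mul (h2 4))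
  · exact ((h1 5).mul (h2 4)).sub ((h1 4).mul (h2 5))
  · exact contDiff_const (c := (0 : ℝ))
  · exact contDiff_const (c := (0 : ℝ))
  · exact contDiff_const (c := (0 : ℝ))

instance : IsManifold 𝓘(ℝ, Alg) ∞ Grp := inferInstanceAs (IsManifold 𝓘(ℝ, Alg) ∞ Alg)

instance : LieGroup 𝓘(ℝ, Alg) ∞ Grp where
  contMDiff_mul := by
    have h : ContDiff ℝ ∞ (fun p : Alg × Alg => p.1 + p.2 + (1 / 2 : ℝ) • ⁅p.1, p.2⁆) :=
      (contDiff_fst.add contDiff_snd).add (contDiff_bracket.const_smul _)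
    have := h.contMDiff
    rw [modelWithCornersSelf_prod, ← chartedSpaceSelf_prod] at this
    exact this
  contMDiff_inv := (contDiff_neg (𝕜 := ℝ) (F := Alg) (n := ∞)).contMDiff

instance : SimplyConnectedSpace Grp := inferInstanceAs (SimplyConnectedSpace Alg)

/-! ### Adjoint and coadjoint action -/

/-- The adjoint representation: `Ad a` is the derivative at the identity of the conjugation
`b ↦ a b a⁻¹`, where the tangent space of the group at its identity is the Lie algebra. -/
def Ad (a : Grp) : Alg →L[ℝ] Alg :=
  mfderiv 𝓘(ℝ, Alg) 𝓘(ℝ, Alg) (fun b : Grp => a * b * a⁻¹) 1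

/-- `Ad (exp x) = e^{ad x} = 1 + ad x`. -/
theorem Ad_apply (a : Grp) (y : Alg) : Ad a y = y + ⁅log a, y⁆ := by
  let L : Alg →L[ℝ] Alg :=
    LinearMap.toContinuousLinearMap (LinearMap.id + (LieAlgebra.ad ℝ Alg (log a) : Alg →ₗ[ℝ] Alg))
  have hL : ∀ z, L z = z + ⁅log a, z⁆ := fun z => rfl
  have h : (fun b : Grp => a * b * a⁻¹) = fun b : Grp => exp (L (log b)) := by
    funext b
    apply log_injective
    rw [log_exp, hL]
    have h' : ⁅log b, log a⁆ = -⁅log a, log b⁆ := (lie_skew _ _).symm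
    simp only [log_mul, log_inv, lie_neg, add_lie, smul_lie, lie_self, lie_lie_eq_zero', h']
    module
  unfold Ad
  rw [h]
  have h2 : mfderiv 𝓘(ℝ, Alg) 𝓘(ℝ, Alg) (fun b : Alg => L b) 0 = L := by
    rw [mfderiv_eq_fderiv]
    exact L.fderiv
  exact (congrArg (fun T : Alg →L[ℝ] Alg => T y) h2).trans (hL y)

/-- The linear dual of the Lie algebra, with its usual topology. -/
abbrev Dual : Type := StrongDual ℝ Alg

/-- The coadjoint action `(a • ξ) y = ξ (Ad(a⁻¹) y)`. -/
instance : MulAction Grp Dual where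
  smul a ξ := ξ.comp (Ad a⁻¹)
  one_smul ξ := by
    ext y
    change ξ (Ad 1⁻¹ y) = ξ y
    simp [Ad_apply]
  mul_smul a b ξ := by
    ext y
    change ξ (Ad (a * b)⁻¹ y) = ξ (Ad b⁻¹ (Ad a⁻¹ y))
    congr 1
    simp only [Ad_apply]
    simp
    abel

theorem smul_apply (a : Grp) (ξ : Dual) (y : Alg) : (a • ξ) y = ξ (Ad a⁻¹ y) := rfl

/-- The center of the Lie algebra, as a linear subspace. -/
abbrev center : Submodule ℝ Alg := (LieAlgebra.center ℝ Alg).toSubmodule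

/-- The restriction of a functional to the center. -/
def restrictCenter (ξ : Dual) : StrongDual ℝ center := ξ.comp center.subtypeL

/-- The set of all functionals that do not vanish identically on the center, with the coadjoint
action of the group. -/
def generic : SubMulAction Grp Dual where
  carrier := {ξ | ¬ ∀ z ∈ center, ξ z = 0}
  smul_mem' a ξ hξ h := hξ fun z hz => by
    have h1 := h z hz
    have h2 : ⁅log a⁻¹, z⁆ = 0 := hz _
    rwa [smul_apply, Ad_apply, h2, add_zero] at h1

/-- The space of coadjoint orbits contained in `generic`, with the quotient topology. -/
abbrev GenericOrbits : Type := MulAction.orbitRel.Quotient Grp generic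

/-- The tangent space at `ξ` of the coadjoint orbit of `ξ`, consisting of the functionals
`y ↦ ξ [y, x]` for `x` in the Lie algebra. -/
def orbitTangent (ξ : Dual) : Submodule ℝ Dual where
  carrier := {η | ∃ x : Alg, ∀ y : Alg, η y = ξ ⁅y, x⁆}
  add_mem' := by
    rintro η₁ η₂ ⟨x₁, h₁⟩ ⟨x₂, h₂⟩
    exact ⟨x₁ + x₂, fun y => by simp [h₁, h₂]⟩
  zero_mem' := ⟨0, fun y => by simp⟩
  smul_mem' := by
    rintro c η ⟨x, h⟩
    exact ⟨c • x, fun y => by simp [h]⟩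

/-- The dimension of the coadjoint orbit of `ξ`. -/
def orbitDim (ξ : Dual) : ℕ := Module.finrank ℝ (orbitTangent ξ)

/-- The polynomial `C(ξ) = ξ₂ ξ₆ + ξ₃ ξ₄ - ξ₁ ξ₅`, where `ξ_j = ⟨ξ, X_j⟩`. -/
def C (ξ : Dual) : ℝ := ξ (X 1) * ξ (X 5) + ξ (X 2) * ξ (X 3) - ξ (X 0) * ξ (X 4)

end G615

end

noncomputable section

namespace G615

/-! Split ξ into its central part (ξ₁, ξ₂, ξ₃) and its tail t = (ξ₄, ξ₅, ξ₆), and put v = (ξ₃, -ξ₁,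
ξ₂). The element exp x fixes the central part and translates the tail by the cross product v × u,
where u = (x₄, x₅, x₆) (`smul_coords`). Since C(ξ) = v · t, it is invariant. If v ≠ 0, the vectors v
× u fill the plane v^⊥, so the orbit is an affine plane with normal v, and the value of C singles it
out among its parallels (`exists_smul_eq`, `orbitTangent_eq_map`). If v = 0, the orbit is a point.

Hence `invariants` induces a continuous bijection on orbits. Its inverse is continuous because the
foot of the perpendicular from 0 to the plane, C v / |v|², gives a continuous section
(`genericSection`). -/

theorem dual_apply (ξ : Dual) (y : Alg) : ξ y = ∑ j, y j * ξ (X j) := by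
  have h : y = ∑ j, y j • X j := (X.sum_repr y).symm
  conv_lhs => rw [h]
  simp [map_sum]

theorem dual_ext {ξ η : Dual} (h : ∀ j, ξ (X j) = η (X j)) : ξ = η := by
  ext y
  simp only [dual_apply _ y, h]

/-- Since `Ad a⁻¹ y = y - ⁅log a, y⁆` and brackets lie in the span of X₁, X₂, X₃, only the tail
moves, by an amount linear in the central part. -/
theorem smul_coords (a : Grp) (ξ : Dual) :
    (a • ξ) (X 0) = ξ (X 0) ∧ (a • ξ) (X 1) = ξ (X 1) ∧ (a • ξ) (X 2) = ξ (X 2) ∧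
    (a • ξ) (X 3) = ξ (X 3) - (log a 5 * ξ (X 0) + log a 4 * ξ (X 1)) ∧
    (a • ξ) (X 4) = ξ (X 4) - (log a 5 * ξ (X 2) - log a 3 * ξ (X 1)) ∧
    (a • ξ) (X 5) = ξ (X 5) + (log a 3 * ξ (X 0) + log a 4 * ξ (X 2)) := by
  have key : ∀ y, (a • ξ) y = ξ y - ∑ k, ⁅log a, y⁆ k * ξ (X k) := fun y => by
    rw [smul_apply, Ad_apply, log_inv, neg_lie, map_add, map_neg, dual_apply ξ ⁅log a, y⁆]
    ring
  refine ⟨?_, ?_, ?_, ?_, ?_, ?_⟩ <;> rw [key] <;> simp [Fin.sum_univ_six, X_coord] <;> ring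

theorem C_smul (a : Grp) (ξ : Dual) : C (a • ξ) = C ξ := by
  obtain ⟨h0, h1, h2, h3, h4, h5⟩ := smul_coords a ξ
  simp only [C, h0, h1, h2, h3, h4, h5]
  ring

/-! ### The center and its dual -/

theorem mem_center_iff (z : Alg) : z ∈ center ↔ z 3 = 0 ∧ z 4 = 0 ∧ z 5 = 0 := by
  constructor
  · intro h
    have h' : ∀ x : Alg, ⁅x, z⁆ = 0 := h
    have e1 := congrArg (fun w : Alg => w 0) (h' (X 5))
    have e2 := congrArg (fun w : Alg => w 2) (h' (X 5))
    have e3 := congrArg (fun w : Alg => w 0) (h' (X 3))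
    simp [X_coord] at e1 e2 e3
    exact ⟨e1, e2, e3⟩
  · rintro ⟨h3, h4, h5⟩ x
    ext j
    fin_cases j <;> simp [h3, h4, h5]

/-- The basis vectors `X₁, X₂, X₃` as elements of the center. -/
def centerX (i : Fin 3) : center :=
  ⟨X (Fin.castLE (by decide) i), (mem_center_iff _).2 (by fin_cases i <;> simp [X_coord])⟩

theorem centerDual_apply (η : StrongDual ℝ center) (z : center) :
    η z = z.1 0 * η (centerX 0) + z.1 1 * η (centerX 1) + z.1 2 * η (centerX 2) := by
  obtain ⟨h3, h4, h5⟩ := (mem_center_iff z.1).1 z.2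
  have h : z = z.1 0 • centerX 0 + z.1 1 • centerX 1 + z.1 2 • centerX 2 := by
    apply Subtype.ext
    ext j
    change z.1 j = z.1 0 * X 0 j + z.1 1 * X 1 j + z.1 2 * X 2 j
    fin_cases j <;> simp [X_coord, h3, h4, h5]
  conv_lhs => rw [h]
  simp

theorem restrictCenter_eq_iff (ξ : Dual) (η : StrongDual ℝ center) :
    restrictCenter ξ = η ↔
      ξ (X 0) = η (centerX 0) ∧ ξ (X 1) = η (centerX 1) ∧ ξ (X 2) = η (centerX 2) := by
  constructor
  · rintro rfl
    exact ⟨rfl, rfl, rfl⟩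
  · rintro ⟨h0, h1, h2⟩
    ext z
    rw [centerDual_apply η z, ← h0, ← h1, ← h2]
    exact centerDual_apply (restrictCenter ξ) z

theorem mem_generic_iff (ξ : Dual) : ξ ∈ generic ↔ restrictCenter ξ ≠ 0 := by
  refine not_congr ⟨fun h => ?_, fun h z hz => ?_⟩
  · ext z
    exact h z z.2
  · exact congrArg (fun T : StrongDual ℝ center => T ⟨z, hz⟩) h

/-- The squared Euclidean length of a functional on the center. -/
def centerNormSq (η : StrongDual ℝ center) : ℝ :=
  η (centerX 0) ^ 2 + η (centerX 1) ^ 2 + η (centerX 2) ^ 2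

theorem centerNormSq_ne_zero {η : StrongDual ℝ center} (h : η ≠ 0) : centerNormSq η ≠ 0 := by
  intro h0
  apply h
  unfold centerNormSq at h0
  have a0 : η (centerX 0) = 0 := by nlinarith
  have a1 : η (centerX 1) = 0 := by nlinarith
  have a2 : η (centerX 2) = 0 := by nlinarith
  ext z
  rw [centerDual_apply, a0, a1, a2]
  simp

theorem centerNormSq_restrictCenter (ξ : Dual) :
    centerNormSq (restrictCenter ξ) = ξ (X 0) ^ 2 + ξ (X 1) ^ 2 + ξ (X 2) ^ 2 := rfl

/-- The coordinate functionals, forming the dual basis of `X`. -/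
def coord (j : Fin 6) : Dual := LinearMap.toContinuousLinearMap (X.coord j)

@[simp] theorem coord_X (i j : Fin 6) : coord i (X j) = if i = j then 1 else 0 := by
  change X.repr (X j) i = _
  rw [X.repr_self, Finsupp.single_apply]
  simp only [eq_comm]

/-! ### Invariants separate generic orbits -/

theorem restrictCenter_smul (a : Grp) (ξ : Dual) : restrictCenter (a • ξ) = restrictCenter ξ := by
  obtain ⟨h0, h1, h2, -⟩ := smul_coords a ξ
  exact (restrictCenter_eq_iff _ _).2 ⟨h0, h1, h2⟩

/-- On generic functionals, the restriction to the center and `C` separate the orbits. -/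
theorem exists_smul_eq {ξ η : Dual} (hξ : ξ ∈ generic)
    (hr : restrictCenter η = restrictCenter ξ) (hC : C η = C ξ) : ∃ a : Grp, a • ξ = η := by
  have hN := centerNormSq_ne_zero ((mem_generic_iff ξ).1 hξ)
  rw [centerNormSq_restrictCenter] at hN
  obtain ⟨e0, e1, e2⟩ := (restrictCenter_eq_iff _ _).1 hr
  change η (X 0) = ξ (X 0) at e0
  change η (X 1) = ξ (X 1) at e1
  change η (X 2) = ξ (X 2) at e2
  simp only [C, e0, e1, e2] at hC
  set N := ξ (X 0) ^ 2 + ξ (X 1) ^ 2 + ξ (X 2) ^ 2 with hNdef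
  let d3 := ξ (X 3) - η (X 3)
  let d4 := ξ (X 4) - η (X 4)
  let d5 := ξ (X 5) - η (X 5)
  -- The required translation is -d, so u must solve v × u = -d. The choice u = (v × d) / |v|² works
  -- when v · d = 0, because v × (v × d) = (v · d) v - |v|² d.
  let x : Alg := ![0, 0, 0, (-ξ (X 0) * d5 - ξ (X 1) * d4) / N,
    (ξ (X 1) * d3 - ξ (X 2) * d5) / N, (ξ (X 2) * d4 + ξ (X 0) * d3) / N]
  have x3 : log (exp x) 3 = (-ξ (X 0) * d5 - ξ (X 1) * d4) / N := rfl
  have x4 : log (exp x) 4 = (ξ (X 1) * d3 - ξ (X 2) * d5) / N := rfl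
  have x5 : log (exp x) 5 = (ξ (X 2) * d4 + ξ (X 0) * d3) / N := rfl
  obtain ⟨h0, h1, h2, h3, h4, h5⟩ := smul_coords (exp x) ξ
  rw [x4, x5] at h3
  rw [x3, x5] at h4
  rw [x3, x4] at h5
  -- Equality of the values of C says exactly that v · d = 0.
  have hd : ξ (X 1) * d5 + ξ (X 2) * d3 - ξ (X 0) * d4 = 0 := by
    simp only [d3, d4, d5]
    linear_combination -hC
  refine ⟨exp x, dual_ext fun j => ?_⟩
  fin_cases j
  · exact h0.trans e0.symm
  · exact h1.trans e1.symm
  · exact h2.trans e2.symm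
  · refine h3.trans (?_ : _ = η (X 3))
    rw [show η (X 3) = ξ (X 3) - d3 by simp only [d3]; ring]
    field_simp
    rw [hNdef]
    linear_combination ξ (X 2) * hd
  · refine h4.trans (?_ : _ = η (X 4))
    rw [show η (X 4) = ξ (X 4) - d4 by simp only [d4]; ring]
    field_simp
    rw [hNdef]
    linear_combination -ξ (X 0) * hd
  · refine h5.trans (?_ : _ = η (X 5))
    rw [show η (X 5) = ξ (X 5) - d5 by simp only [d5]; ring]
    field_simp
    rw [hNdef]
    linear_combination ξ (X 1) * hd

/-! ### Dimension of the orbits -/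

/-- The functionals vanishing on the center, parametrized by their last three coordinates. -/
def ofTail : (Fin 3 → ℝ) →ₗ[ℝ] Dual where
  toFun w := w 0 • coord 3 + w 1 • coord 4 + w 2 • coord 5
  map_add' w w' := by simp only [Pi.add_apply]; module
  map_smul' c w := by simp only [Pi.smul_apply, smul_eq_mul, RingHom.id_apply]; module

theorem ofTail_apply (w : Fin 3 → ℝ) (y : Alg) :
    ofTail w y = w 0 * y 3 + w 1 * y 4 + w 2 * y 5 := rfl

theorem ofTail_injective : Function.Injective ofTail := by
  intro w w' h
  have h3 := congrArg (fun T : Dual => T (X 3)) h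
  have h4 := congrArg (fun T : Dual => T (X 4)) h
  have h5 := congrArg (fun T : Dual => T (X 5)) h
  simp [ofTail_apply, X_coord] at h3 h4 h5
  funext j
  fin_cases j
  exacts [h3, h4, h5]

/-- The linear form on `ℝ³` whose kernel is the tangent space of the orbit of `ξ`. -/
def tailForm (ξ : Dual) : Module.Dual ℝ (Fin 3 → ℝ) :=
  ξ (X 2) • LinearMap.proj 0 - ξ (X 0) • LinearMap.proj 1 + ξ (X 1) • LinearMap.proj 2

theorem tailForm_apply (ξ : Dual) (w : Fin 3 → ℝ) :
    tailForm ξ w = ξ (X 2) * w 0 - ξ (X 0) * w 1 + ξ (X 1) * w 2 := rfl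

theorem tailForm_ne_zero {ξ : Dual} (hξ : ξ ∈ generic) : tailForm ξ ≠ 0 := by
  intro h
  have hN := centerNormSq_ne_zero ((mem_generic_iff ξ).1 hξ)
  rw [centerNormSq_restrictCenter] at hN
  apply hN
  -- Evaluating the form v · w at w = v gives |v|².
  have := congrArg (fun T : Module.Dual ℝ (Fin 3 → ℝ) => T ![ξ (X 2), -ξ (X 0), ξ (X 1)]) h
  simp [tailForm_apply] at this
  linarith

theorem apply_lie (ξ : Dual) (y x : Alg) :
    ξ ⁅y, x⁆ = (x 3 * y 5 - x 5 * y 3) * ξ (X 0) + (x 3 * y 4 - x 4 * y 3) * ξ (X 1) +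
      (x 4 * y 5 - x 5 * y 4) * ξ (X 2) := by
  rw [dual_apply]
  simp [Fin.sum_univ_six]
  ring

/-- The infinitesimal action is also u ↦ v × u, whose image for v ≠ 0 is v^⊥, the kernel of
`tailForm ξ`. -/
theorem orbitTangent_eq_map {ξ : Dual} (hξ : ξ ∈ generic) :
    orbitTangent ξ = (LinearMap.ker (tailForm ξ)).map ofTail := by
  have hN := centerNormSq_ne_zero ((mem_generic_iff ξ).1 hξ)
  rw [centerNormSq_restrictCenter] at hN
  ext η
  constructor
  · rintro ⟨x, hx⟩
    refine ⟨![-(x 5 * ξ (X 0) + x 4 * ξ (X 1)), x 3 * ξ (X 1) - x 5 * ξ (X 2),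
      x 3 * ξ (X 0) + x 4 * ξ (X 2)], ?_, ?_⟩
    · change tailForm ξ _ = 0
      simp [tailForm_apply]
      ring
    · ext y
      rw [hx, apply_lie]
      simp [ofTail_apply]
      ring
  · rintro ⟨w, hw, rfl⟩
    change tailForm ξ w = 0 at hw
    rw [tailForm_apply] at hw
    set N := ξ (X 0) ^ 2 + ξ (X 1) ^ 2 + ξ (X 2) ^ 2 with hNdef
    -- This is u = (w × v) / |v|², a solution of v × u = w for w orthogonal to v.
    let x : Alg := ![0, 0, 0, (ξ (X 0) * w 2 + ξ (X 1) * w 1) / N,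
      (ξ (X 2) * w 2 - ξ (X 1) * w 0) / N, (-ξ (X 2) * w 1 - ξ (X 0) * w 0) / N]
    have x3 : x 3 = (ξ (X 0) * w 2 + ξ (X 1) * w 1) / N := rfl
    have x4 : x 4 = (ξ (X 2) * w 2 - ξ (X 1) * w 0) / N := rfl
    have x5 : x 5 = (-ξ (X 2) * w 1 - ξ (X 0) * w 0) / N := rfl
    refine ⟨x, fun y => ?_⟩
    rw [apply_lie, ofTail_apply, x3, x4, x5]
    field_simp
    rw [hNdef]
    linear_combination (ξ (X 2) * y 3 - ξ (X 0) * y 4 + ξ (X 1) * y 5) * hw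

theorem orbitDim_of_mem_generic {ξ : Dual} (hξ : ξ ∈ generic) : orbitDim ξ = 2 := by
  have h := Module.Dual.finrank_ker_add_one_of_ne_zero (tailForm_ne_zero hξ)
  rw [Module.finrank_fin_fun] at h
  rw [orbitDim, orbitTangent_eq_map hξ,
    ← (Submodule.equivMapOfInjective ofTail ofTail_injective _).finrank_eq]
  omega

theorem orbitDim_of_notMem_generic {ξ : Dual} (hξ : ξ ∉ generic) : orbitDim ξ = 0 := by
  have h : ∀ z ∈ center, ξ z = 0 := not_not.1 hξ
  have : orbitTangent ξ = ⊥ := by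
    rw [eq_bot_iff]
    rintro η ⟨x, hx⟩
    ext y
    rw [hx]
    -- Brackets are central by 2-step nilpotency, so ξ kills them all.
    exact h _ fun u => lie_lie_eq_zero u y x
  rw [orbitDim, this, finrank_bot]

theorem mem_generic_iff_orbitDim (ξ : Dual) : ξ ∈ generic ↔ orbitDim ξ = 2 := by
  refine ⟨orbitDim_of_mem_generic, fun h => ?_⟩
  by_contra hξ
  rw [orbitDim_of_notMem_generic hξ] at h
  omega

/-! ### The space of generic orbits -/

/-- The pair of invariants of a generic functional. -/
def invariants (ξ : generic) : {η : StrongDual ℝ center // η ≠ 0} × ℝ :=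
  (⟨restrictCenter ξ, (mem_generic_iff ξ.1).1 ξ.2⟩, C ξ)

theorem continuous_invariants : Continuous invariants := by
  have h : ∀ y : Alg, Continuous fun ξ : generic => (ξ : Dual) y := fun y =>
    (ContinuousLinearMap.apply ℝ ℝ y).continuous.comp continuous_subtype_val
  refine Continuous.prodMk (Continuous.subtype_mk ?_ _) ?_
  · exact (ContinuousLinearMap.precomp ℝ center.subtypeL).continuous.comp continuous_subtype_val
  · exact (((h _).mul (h _)).add ((h _).mul (h _))).sub ((h _).mul (h _))

/-- The functional with given restriction to the center and given value of `C` whose last three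
coordinates have the least Euclidean norm. -/
def sectionDual (η : StrongDual ℝ center) (c : ℝ) : Dual :=
  η (centerX 0) • coord 0 + η (centerX 1) • coord 1 + η (centerX 2) • coord 2 +
    (c / centerNormSq η) • (η (centerX 2) • coord 3 - η (centerX 0) • coord 4 +
      η (centerX 1) • coord 5)

theorem restrictCenter_sectionDual (η : StrongDual ℝ center) (c : ℝ) :
    restrictCenter (sectionDual η c) = η := by
  rw [restrictCenter_eq_iff]
  refine ⟨?_, ?_, ?_⟩ <;> simp [sectionDual]

theorem C_sectionDual {η : StrongDual ℝ center} (hη : η ≠ 0) (c : ℝ) :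
    C (sectionDual η c) = c := by
  have hN := centerNormSq_ne_zero hη
  simp [C, sectionDual]
  field_simp
  simp only [centerNormSq]
  ring

/-- `sectionDual` as a section of `invariants`. -/
def genericSection (p : {η : StrongDual ℝ center // η ≠ 0} × ℝ) : generic :=
  ⟨sectionDual p.1 p.2, (mem_generic_iff _).2 (by
    rw [restrictCenter_sectionDual]; exact p.1.2)⟩

theorem invariants_genericSection (p : {η : StrongDual ℝ center // η ≠ 0} × ℝ) :
    invariants (genericSection p) = p :=
  Prod.ext (Subtype.ext (restrictCenter_sectionDual _ _)) (C_sectionDual p.1.2 _)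

theorem continuous_genericSection : Continuous genericSection := by
  have h : ∀ z : center, Continuous
      fun p : {η : StrongDual ℝ center // η ≠ 0} × ℝ => (p.1 : StrongDual ℝ center) z := fun z =>
    (ContinuousLinearMap.apply ℝ ℝ z).continuous.comp (continuous_subtype_val.comp continuous_fst)
  have hN : Continuous
      fun p : {η : StrongDual ℝ center // η ≠ 0} × ℝ => centerNormSq p.1 :=
    (((h _).pow 2).add ((h _).pow 2)).add ((h _).pow 2)
  have hq := continuous_snd.div hN fun p => centerNormSq_ne_zero p.1.2
  refine Continuous.subtype_mk ?_ _
  exact ((((h _).smul continuous_const).add ((h _).smul continuous_const)).add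
    ((h _).smul continuous_const)).add (hq.smul ((((h _).smul continuous_const).sub
      ((h _).smul continuous_const)).add ((h _).smul continuous_const)))

/-- This yields both that the map on orbits is well defined and that it is injective. -/
theorem invariants_eq_iff (ξ η : generic) :
    invariants ξ = invariants η ↔ MulAction.orbitRel Grp generic ξ η := by
  rw [MulAction.orbitRel_apply]
  constructor
  · intro h
    obtain ⟨a, ha⟩ := exists_smul_eq η.2 (congrArg (fun p => p.1.1) h) (congrArg Prod.snd h)
    exact ⟨a, Subtype.ext ha⟩
  · rintro ⟨a, rfl⟩
    exact Prod.ext (Subtype.ext (restrictCenter_smul a η.1)) (C_smul a η.1)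

/-- The orbits in `generic` are parametrized homeomorphically by their invariants. -/
def orbitHomeomorph : GenericOrbits ≃ₜ {η : StrongDual ℝ center // η ≠ 0} × ℝ where
  toFun := Quotient.lift invariants fun ξ η h => (invariants_eq_iff ξ η).2 h
  invFun p := Quotient.mk _ (genericSection p)
  left_inv q := by
    induction q using Quotient.inductionOn with
    | h ξ => exact Quotient.sound ((invariants_eq_iff _ _).1 (invariants_genericSection _))
  right_inv p := invariants_genericSection p
  continuous_toFun := continuous_invariants.quotient_lift _
  continuous_invFun := continuous_quotient_mk'.comp continuous_genericSection

end G615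

end

theorem proposition7p3 :
    (∀ ξ : G615.Dual, ∀ η ∈ MulAction.orbit G615.Grp ξ, G615.C η = G615.C ξ) ∧
    (∀ ξ : G615.Dual, ξ ∈ G615.generic ↔ G615.orbitDim ξ = 2) ∧
    ∃ Ψ : G615.GenericOrbits ≃ₜ {η : StrongDual ℝ G615.center // η ≠ 0} × ℝ,
      ∀ ξ : G615.generic,
        ((Ψ (Quotient.mk _ ξ)).1 : StrongDual ℝ G615.center) = G615.restrictCenter ξ ∧
        (Ψ (Quotient.mk _ ξ)).2 = G615.C ξ := by
  refine ⟨?_, G615.mem_generic_iff_orbitDim, G615.orbitHomeomorph, fun ξ => ⟨rfl, rfl⟩⟩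
  rintro ξ _ ⟨a, rfl⟩
  exact G615.C_smul a ξ
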